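/- A graph is simplicial, and its vertex set carries the shortest path metric. A \emph{2-dimensional systolic complex} is a simply connected simplicial complex $Y$ of dimension at most $2$ in which the link of every vertex $v$ has girth at least $6$; here the link of $v$ is the graph whose vertices are the neighbours of $v$, two of them being adjacent iff they span a triangle of $Y$ together with $v$ (a graph without cycles has infinite girth). Let $Y$ be a 2-dimensional systolic complex with a basepoint $\ast\in Y^0$, and let $Y^1$ be its 1-skeleton, with metric $d_{Y^1}$. The \emph{squaring} $(X_Y,\ast)$ of $(Y,\ast)$ is the based square complex whose 1-skeleton $X_Y^1$ is the graph with vertex set $Y^0$ and with those edges $\{u,v\}$ of $Y^1$ for which $d_{Y^1}(\ast,u)\neq d_{Y^1}(\ast,v)$, and which has exactly one square attached along each embedded $4$-cycle of $X_Y^1$. Theorem. $Y^1$ and $X_Y^1$ are connected graphs and $Y^1$ is quasi-isometric to $X_Y^1$. More precisely, the identity map of $Y^0$ is a quasi-isometry, with \[ d_{Y^1}(u,v)\le d_{X_Y^1}(u,v)\le 2\,d_{Y^1}(u,v)\qquad\text{for all } u,v\in Y^0. \] -/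

import Mathlib

namespace SystolicSquaring

/-- A point of the geometric realization of an abstract simplicial complex, in barycentric
coordinates: nonnegative weights that are supported on a face and sum to one. -/
@[ext]
structure Realization {V : Type*} (K : AbstractSimplicialComplex V) where
  /-- the barycentric coordinates -/
  coord : V → ℝ
  coord_nonneg : ∀ v, 0 ≤ coord v
  exists_face : ∃ s ∈ K.faces, (∀ v, v ∉ s → coord v = 0) ∧ ∑ v ∈ s, coord v = 1

/-- The inclusion of the closed simplex spanned by a face (extension of coordinates by zero). -/
noncomputable def faceInclusion {V : Type*} (K : AbstractSimplicialComplex V) (s : K.faces)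
    (x : stdSimplex ℝ {v : V // v ∈ s.1}) : Realization K where
  coord v := by classical exact if h : v ∈ s.1 then x.1 ⟨v, h⟩ else 0
  coord_nonneg v := by
    by_cases h : v ∈ s.1
    · simpa [h] using x.2.1 ⟨v, h⟩
    · simp [h]
  exists_face := by
    refine ⟨s.1, s.2, fun v hv => by simp [hv], ?_⟩
    rw [← Finset.sum_coe_sort, ← x.2.2]
    exact Finset.sum_congr rfl fun v _ => by simp [v.2]

/-- The weak (CW) topology: a set is open iff its trace on every closed simplex is open. -/
noncomputable instance instTopologicalSpaceRealization {V : Type*} (K : AbstractSimplicialComplex V) :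
    TopologicalSpace (Realization K) :=
  ⨆ s : K.faces, TopologicalSpace.coinduced (faceInclusion K s) inferInstance

/-- The 1-skeleton of a simplicial complex, as a simple graph on its vertices. -/
def oneSkeleton {V : Type*} (K : AbstractSimplicialComplex V) : SimpleGraph V where
  Adj u v := u ≠ v ∧ ∃ s ∈ K.faces, ∀ w, w ∈ s ↔ w = u ∨ w = v
  symm := ⟨fun _ _ h => ⟨h.1.symm, h.2.imp fun _ hs => ⟨hs.1, fun w => (hs.2 w).trans or_comm⟩⟩⟩
  loopless := ⟨fun _ h => h.1 rfl⟩

/-- The link of a vertex `v` (in a complex of dimension at most two): its vertices are the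
neighbours of `v`, and two of them are joined by an edge iff they span a triangle with `v`. -/
def link {V : Type*} (K : AbstractSimplicialComplex V) (v : V) :
    SimpleGraph {w : V // (oneSkeleton K).Adj v w} where
  Adj a b := a ≠ b ∧ ∃ s ∈ K.faces, ∀ w, w ∈ s ↔ w = v ∨ w = a.1 ∨ w = b.1
  symm := ⟨fun _ _ h =>
    ⟨h.1.symm, h.2.imp fun _ hs => ⟨hs.1, fun w => (hs.2 w).trans (or_congr_right or_comm)⟩⟩⟩
  loopless := ⟨fun _ h => h.1 rfl⟩

/-- Two-dimensional systolic complexes: simply connected simplicial complexes of dimension at most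
two in which every vertex link has girth at least six (a forest has infinite girth). -/
structure IsTwoDimSystolic {V : Type*} (K : AbstractSimplicialComplex V) : Prop where
  card_le : ∀ s ∈ K.faces, s.card ≤ 3
  simplyConnected : SimplyConnectedSpace (Realization K)
  girth_link : ∀ v : V, 6 ≤ (link K v).egirth

/-- The edge set of an embedded 4-cycle of a graph. -/
def IsFourCycle {V : Type*} (G : SimpleGraph V) (q : Set (Sym2 V)) : Prop :=
  ∃ a b c d : V, G.Adj a b ∧ G.Adj b c ∧ G.Adj c d ∧ G.Adj d a ∧ a ≠ c ∧ b ≠ d ∧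
    q = {s(a, b), s(b, c), s(c, d), s(d, a)}

/-- A based square complex in which every square is attached along an embedded 4-cycle and is
determined by its boundary. -/
structure BasedSquareComplex (V : Type*) where
  /-- the 1-skeleton -/
  skeleton : SimpleGraph V
  /-- the squares, each given by the edge set of its boundary cycle -/
  squares : Set (Set (Sym2 V))
  isFourCycle : ∀ q ∈ squares, IsFourCycle skeleton q
  /-- the basepoint -/
  base : V

/-- All vertices, and those edges of the 1-skeleton whose endpoints are not equidistant from
the basepoint. -/
def squaringSkeleton {V : Type*} (K : AbstractSimplicialComplex V) (base : V) :
    SimpleGraph V where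
  Adj u v := (oneSkeleton K).Adj u v ∧
    (oneSkeleton K).dist base u ≠ (oneSkeleton K).dist base v
  symm := ⟨fun _ _ h => ⟨h.1.symm, h.2.symm⟩⟩
  loopless := ⟨fun _ h => h.2 rfl⟩

/-- The squaring of a based simplicial complex: attach a unique square to each embedded 4-cycle
of `squaringSkeleton K base`. -/
def squaring {V : Type*} (K : AbstractSimplicialComplex V) (base : V) :
    BasedSquareComplex V where
  skeleton := squaringSkeleton K base
  squares := {q | IsFourCycle (squaringSkeleton K base) q}
  isFourCycle _ h := h
  base := base

/-- `f` is a quasi-isometry between the vertex sets of two graphs with their shortest path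
metrics. Meant for connected graphs. -/
def IsQuasiIsometry {V W : Type*} (G : SimpleGraph V) (H : SimpleGraph W) (f : V → W) : Prop :=
  ∃ L C : ℝ, 1 ≤ L ∧ 0 ≤ C ∧
    (∀ u v, L⁻¹ * G.dist u v - C ≤ H.dist (f u) (f v) ∧
      (H.dist (f u) (f v) : ℝ) ≤ L * G.dist u v + C) ∧
    ∀ w, ∃ v, (H.dist w (f v) : ℝ) ≤ C

/-- Two graphs are quasi-isometric: both are connected, so that the shortest path distance is a
metric, and there is a quasi-isometry between their vertex sets. -/
def QuasiIsometric {V W : Type*} (G : SimpleGraph V) (H : SimpleGraph W) : Prop :=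
  G.Connected ∧ H.Connected ∧ ∃ f : V → W, IsQuasiIsometry G H f

end SystolicSquaring

open SystolicSquaring

/-! The bound `d_Y ≤ d_X` holds because the squaring skeleton is a subgraph of the 1-skeleton. For
the other bound, only edges between vertices equidistant from the basepoint have to be replaced. The
triangle condition (`IsTwoDimSystolic.triangle_condition`) replaces each of them by two edges
through a common neighbour closer to the basepoint.

To prove the triangle condition, a covering of the complex is built sphere by sphere around a lift
of the basepoint. At a vertex of a sphere, the lower neighbours are pairwise adjacent in the link,
the other link vertices adjacent to a lower one lift to the same sphere, and the rest lift to the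
next sphere. Girth at least six rules out the short cycles in links that would spoil this pattern
one level up (`Sphere.next`). In the covering every edge inside a sphere has a common lower
neighbour by construction.

Simple connectivity gives a section of the covering (`exists_section_of_unique_lifts`). Along it the
level equals the distance from the basepoint, so the property descends to the complex. -/

namespace SystolicSquaring

open Set Topology

/-! ### Topology of the realization: open stars and connectedness -/

section Realization

variable {V : Type*} (K : AbstractSimplicialComplex V)

lemma continuous_faceInclusion (s : K.faces) : Continuous (faceInclusion K s) :=
  continuous_iff_coinduced_le.2 (le_iSup (fun s : K.faces =>
    TopologicalSpace.coinduced (faceInclusion K s) inferInstance) s)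

lemma faceInclusion_coord (s : K.faces) (x : stdSimplex ℝ {v : V // v ∈ s.1}) {v : V}
    (h : v ∈ s.1) : (faceInclusion K s x).coord v = x.1 ⟨v, h⟩ := by
  simp [faceInclusion, h]

lemma faceInclusion_coord_of_notMem (s : K.faces) (x : stdSimplex ℝ {v : V // v ∈ s.1}) {v : V}
    (h : v ∉ s.1) : (faceInclusion K s x).coord v = 0 := by
  simp [faceInclusion, h]

variable {K}

lemma continuous_coord (v : V) : Continuous fun x : Realization K => x.coord v := by
  refine continuous_iSup_dom.2 fun s => continuous_coinduced_dom.2 ?_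
  by_cases h : v ∈ s.1
  · have : (fun x : Realization K => x.coord v) ∘ faceInclusion K s = fun x => x.1 ⟨v, h⟩ :=
      funext fun x => faceInclusion_coord K s x h
    rw [this]
    exact (continuous_apply _).comp continuous_subtype_val
  · have : (fun x : Realization K => x.coord v) ∘ faceInclusion K s = fun _ => 0 :=
      funext fun x => faceInclusion_coord_of_notMem K s x h
    rw [this]
    exact continuous_const

lemma Realization.exists_eq_faceInclusion (x : Realization K) :
    ∃ (s : K.faces) (y : stdSimplex ℝ {v : V // v ∈ s.1}), faceInclusion K s y = x := by
  obtain ⟨s, hs, h0, h1⟩ := x.exists_face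
  refine ⟨⟨s, hs⟩, ⟨fun v => x.coord v, fun v => x.coord_nonneg v, ?_⟩, ?_⟩
  · exact (Finset.sum_coe_sort s x.coord).trans h1
  · ext v
    by_cases h : v ∈ s
    · rw [faceInclusion_coord K ⟨s, hs⟩ _ h]
    · rw [faceInclusion_coord_of_notMem K ⟨s, hs⟩ _ h, h0 v h]

/-- Needed for lifting maps through coverings. The trace of a path component on a closed simplex is
open because the simplex is convex, hence locally path connected. -/
instance locallyPathConnectedSpace_realization :
    LocallyPathConnectedSpace (Realization K) := by
  have hloc (s : K.faces) : LocallyPathConnectedSpace (stdSimplex ℝ {v : V // v ∈ s.1}) :=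
    (convex_stdSimplex ℝ _).locallyPathConnectedSpace
  refine locallyPathConnectedSpace_iff_isOpen_pathComponentIn.2 fun x u hu => ?_
  refine isOpen_iSup_iff.2 fun s => ?_
  have hc := LocallyPathConnectedSpace.coinduced (faceInclusion K s)
  refine isOpen_coinduced.2 (isOpen_iff_mem_nhds.2 fun y hy => ?_)
  have hu' : IsOpen (faceInclusion K s ⁻¹' u) := hu.preimage (continuous_faceInclusion K s)
  have hyu : faceInclusion K s y ∈ u := pathComponentIn_subset hy
  refine Filter.mem_of_superset ((hu'.pathComponentIn y).mem_nhds
    (mem_pathComponentIn_self hyu)) fun z hz => ?_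
  rw [mem_preimage, ← pathComponentIn_congr hy]
  have := hz.map (continuous_faceInclusion K s)
  exact JoinedIn.mono this (image_preimage_subset _ _)

/-- The open star of a vertex. -/
def openStar (K : AbstractSimplicialComplex V) (v : V) : Set (Realization K) :=
  {x | 0 < x.coord v}

lemma isOpen_openStar (v : V) : IsOpen (openStar K v) :=
  isOpen_lt continuous_const (continuous_coord v)

lemma Realization.exists_mem_openStar (x : Realization K) : ∃ v, x ∈ openStar K v := by
  obtain ⟨s, hs, h0, h1⟩ := x.exists_face
  by_contra! h
  have : ∑ v ∈ s, x.coord v = 0 :=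
    Finset.sum_eq_zero fun v _ => le_antisymm (not_lt.1 (h v)) (x.coord_nonneg v)
  linarith

lemma Realization.exists_face_subset (x : Realization K) :
    ∃ s ∈ K.faces, ∀ v, x ∈ openStar K v → v ∈ s := by
  obtain ⟨s, hs, h0, h1⟩ := x.exists_face
  refine ⟨s, hs, fun v hv => ?_⟩
  by_contra h
  exact (ne_of_gt hv) (h0 v h)

/-- A vertex as a point of the realization. -/
noncomputable def vertexPoint (K : AbstractSimplicialComplex V) (v : V) : Realization K where
  coord w := by classical exact if w = v then 1 else 0
  coord_nonneg w := by split_ifs <;> norm_num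
  exists_face := ⟨{v}, K.singleton_mem v, fun w hw => by simpa using hw,
    by rw [Finset.sum_singleton]; simp⟩

lemma vertexPoint_mem_openStar (v : V) : vertexPoint K v ∈ openStar K v := by
  simp [openStar, vertexPoint]

lemma eq_of_vertexPoint_mem_openStar {v w : V} (h : vertexPoint K v ∈ openStar K w) : w = v := by
  by_contra h'
  simp [openStar, vertexPoint, h'] at h

/-- In each closed simplex containing `v`, the points with positive `v`-coordinate form a convex set
through the vertex. -/
lemma isPreconnected_openStar (v : V) : IsPreconnected (openStar K v) := by
  refine isPreconnected_of_forall (vertexPoint K v) fun y hy => ?_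
  obtain ⟨s, x, rfl⟩ := y.exists_eq_faceInclusion
  have hv : v ∈ s.1 := by
    by_contra h
    exact (ne_of_gt hy) (faceInclusion_coord_of_notMem K s x h)
  let A : Set (stdSimplex ℝ {v : V // v ∈ s.1}) := {x | 0 < x.1 ⟨v, hv⟩}
  have hA : IsPreconnected A := by
    rw [← IsInducing.subtypeVal.isPreconnected_image]
    have : Subtype.val '' A = stdSimplex ℝ _ ∩ {x | 0 < x ⟨v, hv⟩} := by
      ext z
      simp [A, and_comm]
    rw [this]
    refine Convex.isPreconnected ((convex_stdSimplex ℝ _).inter ?_)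
    exact convex_halfSpace_gt (LinearMap.proj (R := ℝ) (φ := fun _ => ℝ) _).isLinear 0
  refine ⟨faceInclusion K s '' A, ?_, ?_, ⟨x, ?_, rfl⟩,
    hA.image _ (continuous_faceInclusion K s).continuousOn⟩
  · rintro _ ⟨z, hz, rfl⟩
    exact (show 0 < z.1 ⟨v, hv⟩ from hz).trans_eq (faceInclusion_coord K s z hv).symm
  · classical
    refine ⟨⟨Pi.single ⟨v, hv⟩ 1, single_mem_stdSimplex ℝ _⟩, by simp [A], ?_⟩
    ext w
    by_cases hw : w ∈ s.1
    · simp [faceInclusion_coord K s _ hw, vertexPoint, Pi.single_apply]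
    · rw [faceInclusion_coord_of_notMem K s _ hw]
      have : w ≠ v := fun h => hw (h ▸ hv)
      simp [vertexPoint, this]
  · exact (show 0 < (faceInclusion K s x).coord v from hy).trans_eq
      (faceInclusion_coord K s x hv)

lemma exists_mem_openStar_inter {u v : V} (h : (oneSkeleton K).Adj u v) :
    ∃ x, x ∈ openStar K u ∩ openStar K v := by
  classical
  obtain ⟨hne, s, hs, hsm⟩ := h
  have hs' : s = {u, v} := by ext; simp [hsm]
  refine ⟨⟨fun w => if w = u ∨ w = v then 1 / 2 else 0, fun w => by split_ifs <;> norm_num,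
    s, hs, fun w hw => ?_, ?_⟩, ?_, ?_⟩
  · rw [hsm] at hw
    simp [hw]
  · subst hs'
    rw [Finset.sum_pair hne]
    norm_num
  · simp [openStar]
  · simp [openStar]

/-- Open stars of distinct vertices meet only if the vertices are adjacent, so the stars of the
vertices reachable from `v₀` have a clopen union. -/
lemma connected_oneSkeleton [ConnectedSpace (Realization K)] : (oneSkeleton K).Connected := by
  obtain ⟨x₀⟩ := ‹ConnectedSpace (Realization K)›.toNonempty
  obtain ⟨v₀, hv₀⟩ := x₀.exists_mem_openStar
  have hadj {x : Realization K} {u v : V} (hu : x ∈ openStar K u) (hv : x ∈ openStar K v) :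
      (oneSkeleton K).Reachable u v := by
    by_cases huv : u = v
    · exact huv ▸ SimpleGraph.Reachable.refl _
    classical
    obtain ⟨s, hs, h⟩ := x.exists_face_subset
    refine SimpleGraph.Adj.reachable ⟨huv, {u, v}, ?_, by simp⟩
    refine (K.isRelLowerSet_faces hs).2 ?_ (by simp)
    intro w hw
    rcases Finset.mem_insert.1 hw with rfl | hw
    · exact h _ hu
    · rw [Finset.mem_singleton.1 hw]
      exact h _ hv
  let A : Set (Realization K) := ⋃ v ∈ {v | (oneSkeleton K).Reachable v₀ v}, openStar K v
  let B : Set (Realization K) := ⋃ v ∈ {v | ¬ (oneSkeleton K).Reachable v₀ v}, openStar K v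
  have hAB : Aᶜ = B := by
    ext x
    obtain ⟨v, hv⟩ := x.exists_mem_openStar
    simp only [A, B, mem_compl_iff, mem_iUnion, exists_prop, mem_ofPred_eq, not_exists, not_and]
    constructor
    · exact fun h => ⟨v, fun h' => h v h' hv, hv⟩
    · rintro ⟨u, hu, hxu⟩ w hw hxw
      exact hu (hw.trans (hadj hxw hxu))
  have hclopen : IsClopen A := by
    refine ⟨⟨hAB ▸ ?_⟩, ?_⟩ <;>
    exact isOpen_biUnion fun v _ => isOpen_openStar v
  have huniv : A = univ := hclopen.eq_univ ⟨x₀, mem_biUnion (SimpleGraph.Reachable.refl v₀) hv₀⟩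
  have hreach (v : V) : (oneSkeleton K).Reachable v₀ v := by
    have : vertexPoint K v ∈ A := huniv ▸ mem_univ _
    simp only [A, mem_iUnion, exists_prop, mem_ofPred_eq] at this
    obtain ⟨w, hw, hv⟩ := this
    exact eq_of_vertexPoint_mem_openStar hv ▸ hw
  have : Nonempty V := ⟨v₀⟩
  exact ⟨fun u v => (hreach u).symm.trans (hreach v)⟩

/-- Three distinct vertices spanning a triangle. -/
def IsTriangle (K : AbstractSimplicialComplex V) (u v w : V) : Prop :=
  u ≠ v ∧ u ≠ w ∧ v ≠ w ∧ ∃ s ∈ K.faces, ∀ x, x ∈ s ↔ x = u ∨ x = v ∨ x = w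

lemma adj_of_mem_face {s : Finset V} (hs : s ∈ K.faces) {u v : V} (hu : u ∈ s) (hv : v ∈ s)
    (h : u ≠ v) : (oneSkeleton K).Adj u v := by
  classical
  refine ⟨h, {u, v}, (K.isRelLowerSet_faces hs).2 ?_ (by simp), by simp⟩
  simp [Finset.insert_subset_iff, hu, hv]

lemma isTriangle_of_mem_face {s : Finset V} (hs : s ∈ K.faces) {u v w : V} (hu : u ∈ s)
    (hv : v ∈ s) (hw : w ∈ s) (huv : u ≠ v) (huw : u ≠ w) (hvw : v ≠ w) : IsTriangle K u v w := by
  classical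
  refine ⟨huv, huw, hvw, {u, v, w}, (K.isRelLowerSet_faces hs).2 ?_ (by simp), by simp⟩
  simp [Finset.insert_subset_iff, hu, hv, hw]

/-! ### From simple connectivity to sections of combinatorial coverings -/

/-- A flat bundle over the realization of a simply connected complex has a flat section. -/
theorem exists_flat_section [SimplyConnectedSpace (Realization K)] {F : Type*}
    (φ : V → V → F → F) (hself : ∀ v a, φ v v a = a)
    (hsymm : ∀ u v a, (oneSkeleton K).Adj u v → φ v u (φ u v a) = a)
    (htri : ∀ u v w a, IsTriangle K u v w → φ v w (φ u v a) = φ u w a) (v₀ : V) (a₀ : F) :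
    ∃ g : V → F, g v₀ = a₀ ∧ ∀ u v, (oneSkeleton K).Adj u v → φ u v (g u) = g v := by
  classical
  let _ : TopologicalSpace F := ⊥
  have : DiscreteTopology F := ⟨rfl⟩
  have hcomp : ∀ i j k, ∀ x ∈ openStar K i ∩ openStar K j ∩ openStar K k, ∀ a,
      φ j k (φ i j a) = φ i k a := by
    rintro i j k x ⟨⟨hi, hj⟩, hk⟩ a
    obtain ⟨s, hs, h⟩ := x.exists_face_subset
    by_cases hij : i = j
    · rw [hij, hself]
    by_cases hjk : j = k
    · rw [hjk, hself]
    by_cases hik : i = k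
    · subst hik
      rw [hself, hsymm _ _ _ (adj_of_mem_face hs (h _ hi) (h _ hj) hij)]
    · exact htri _ _ _ _ (isTriangle_of_mem_face hs (h _ hi) (h _ hj) (h _ hk) hij hik hjk)
  -- With discrete fibre and transition maps `φ` between open stars, the bundle is a covering, so
  -- the identity of the simply connected base lifts to a section.
  let Z : FiberBundleCore V (Realization K) F :=
    { baseSet := openStar K
      isOpen_baseSet := isOpen_openStar
      indexAt := fun x => x.exists_mem_openStar.choose
      mem_baseSet_at := fun x => x.exists_mem_openStar.choose_spec
      coordChange := fun i j _ => φ i j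
      coordChange_self := fun i _ _ a => hself i a
      continuousOn_coordChange := fun i j =>
        (continuous_of_discreteTopology.comp continuous_snd).continuousOn
      coordChange_comp := hcomp }
  have hcov : IsCoveringMap Z.proj := FiberBundle.isCoveringMap (F := F) (E := Z.Fiber)
  have hidx : Z.indexAt (vertexPoint K v₀) = v₀ :=
    eq_of_vertexPoint_mem_openStar (Z.mem_baseSet_at _)
  obtain ⟨σ, ⟨hσ0, hσ⟩, -⟩ := hcov.existsUnique_continuousMap_lifts
    (ContinuousMap.id (Realization K)) (vertexPoint K v₀) ⟨vertexPoint K v₀, a₀⟩ rfl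
  have hσx (x) : (σ x).proj = x := congrFun hσ x
  let τ (v : V) (x : Realization K) : F := (Z.localTriv v (σ x)).2
  have hτ (v : V) (x) : τ v x = φ (Z.indexAt x) v (σ x).2 := by
    have : τ v x = φ (Z.indexAt (σ x).proj) v (σ x).2 := rfl
    rw [this, hσx]
  have hτc (v : V) : ContinuousOn (τ v) (openStar K v) := by
    refine continuous_snd.comp_continuousOn
      ((Z.localTriv v).continuousOn_toFun.comp σ.continuous.continuousOn fun x hx => ?_)
    change (σ x).proj ∈ openStar K v
    rwa [hσx]
  refine ⟨fun v => τ v (vertexPoint K v), ?_, fun u v huv => ?_⟩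
  · dsimp only
    have h2 : (σ (vertexPoint K v₀)).2 = a₀ := by rw [hσ0]
    rw [hτ, hidx]
    exact (hself v₀ _).trans h2
  -- Read in its own chart, the section is constant on each connected star; the two constants are
  -- compared where the stars meet.
  · obtain ⟨x, hxu, hxv⟩ := exists_mem_openStar_inter huv
    dsimp only
    rw [(isPreconnected_openStar u).constant (hτc u) (vertexPoint_mem_openStar u) hxu,
      (isPreconnected_openStar v).constant (hτc v) (vertexPoint_mem_openStar v) hxv, hτ, hτ]
    exact hcomp _ _ _ x ⟨⟨Z.mem_baseSet_at x, hxu⟩, hxv⟩ _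

/-- A combinatorial covering of a simply connected complex has a section: if edges lift uniquely
along `p : E → V` to `R`-related pairs and triangles lift to triangles, then `p` has a section
sending edges to `R`-related pairs. -/
theorem exists_section_of_unique_lifts [SimplyConnectedSpace (Realization K)] {E : Type*}
    (p : E → V) (R : E → E → Prop) (hsymm : ∀ {a b}, R a b → R b a)
    (hlift : ∀ a v, (oneSkeleton K).Adj (p a) v → ∃ b, R a b ∧ p b = v)
    (huniq : ∀ {a b c}, R a b → R a c → p b = p c → b = c)
    (htri : ∀ {a b c}, R a b → R a c → IsTriangle K (p a) (p b) (p c) → R b c) (e₀ : E) :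
    ∃ g : V → E, g (p e₀) = e₀ ∧ (∀ v, p (g v) = v) ∧
      ∀ u v, (oneSkeleton K).Adj u v → R (g u) (g v) := by
  classical
  have hlift' {u v : V} (h : (oneSkeleton K).Adj u v) (a : {a // p a = u}) :
      ∃ b : {b // p b = v}, R a.1 b.1 := by
    obtain ⟨b, hab, hb⟩ := hlift a.1 v (a.2.symm ▸ h)
    exact ⟨⟨b, hb⟩, hab⟩
  have hequiv (u v : V) : Nonempty ({a // p a = u} ≃ {a // p a = v}) := by
    obtain ⟨w⟩ := (connected_oneSkeleton (K := K)).preconnected u v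
    induction w with
    | nil => exact ⟨Equiv.refl _⟩
    | @cons u v w h _ ih =>
      obtain ⟨e⟩ := ih
      choose f hf using hlift' h
      choose f' hf' using hlift' h.symm
      refine ⟨Equiv.trans ⟨f, f', fun a => ?_, fun a => ?_⟩ e⟩
      · exact Subtype.ext (huniq (hf' _) (hsymm (hf a)) ((f' (f a)).2.trans a.2.symm))
      · exact Subtype.ext (huniq (hf _) (hsymm (hf' a)) ((f (f' a)).2.trans a.2.symm))
  -- Arbitrary identifications of all fibres with the one over `p e₀`, which serves as the fibre of
  -- the flat bundle.
  let h (v : V) := (hequiv (p e₀) v).some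
  let m (u v : V) (a : {a // p a = u}) : {a // p a = v} :=
    if huv : u = v then ⟨a.1, a.2.trans huv⟩
    else if hadj : (oneSkeleton K).Adj u v then (hlift' hadj a).choose
    -- Arbitrary value: no flatness condition involves distinct non-adjacent vertices.
    else h v ((h u).symm a)
  have hm_self (v a) : m v v a = a := by simp [m]
  have hm {u v : V} (huv : (oneSkeleton K).Adj u v) (a : {a // p a = u}) :
      R a.1 (m u v a).1 := by
    simp only [m, dif_neg huv.ne, dif_pos huv]
    exact (hlift' huv a).choose_spec
  obtain ⟨g, hg₀, hg⟩ := exists_flat_section (K := K)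
    (fun u v a => (h v).symm (m u v (h u a))) (fun v a => by simp [hm_self])
    (fun u v a huv => by
      rw [Equiv.apply_symm_apply, Equiv.symm_apply_eq]
      exact Subtype.ext (huniq (hm huv.symm _) (hsymm (hm huv _))
        ((m v u _).2.trans (h u a).2.symm)))
    (fun u v w a ht => by
      rw [Equiv.apply_symm_apply, EmbeddingLike.apply_eq_iff_eq]
      obtain ⟨huv, huw, hvw, s, hs, hmem⟩ := ht
      have hu : u ∈ s := by simp [hmem]
      have hv : v ∈ s := by simp [hmem]
      have hw : w ∈ s := by simp [hmem]
      have h₁ := hm (adj_of_mem_face hs hu hv huv) (h u a)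
      have h₂ := hm (adj_of_mem_face hs hu hw huw) (h u a)
      have h₃ := hm (adj_of_mem_face hs hv hw hvw) (m u v (h u a))
      refine Subtype.ext (huniq h₃ (htri h₁ h₂ ?_) ((m v w _).2.trans (m u w _).2.symm))
      rw [(h u a).2, (m u v (h u a)).2, (m u w (h u a)).2]
      exact ⟨huv, huw, hvw, s, hs, hmem⟩)
    (p e₀) ((h (p e₀)).symm ⟨e₀, rfl⟩)
  refine ⟨fun v => (h v (g v)).1, by simp [hg₀], fun v => (h v (g v)).2, fun u v huv => ?_⟩
  have := hm huv (h u (g u))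
  rwa [(Equiv.symm_apply_eq _).1 (hg u v huv)] at this

end Realization

/-! ### Short closed walks in graphs of girth at least six -/

section Girth

variable {W : Type*} {G : SimpleGraph W}

lemma not_adj_of_six_le_egirth (hG : 6 ≤ G.egirth) {a b c : W} (hab : G.Adj a b)
    (hbc : G.Adj b c) : ¬ G.Adj c a := by
  intro hca
  have h : (SimpleGraph.Walk.cons hab (.cons hbc (.cons hca .nil))).IsCycle := by
    have := hab.ne; have := hbc.ne; have := hca.ne
    simp [SimpleGraph.Walk.cons_isCycle_iff, *]
    grind
  have := hG.trans (SimpleGraph.egirth_le_length h)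
  simp at this
  norm_cast at this

lemma four_cycle_of_six_le_egirth (hG : 6 ≤ G.egirth) {a b c d : W} (hab : G.Adj a b)
    (hbc : G.Adj b c) (hcd : G.Adj c d) (hda : G.Adj d a) : a = c ∨ b = d := by
  by_contra! hne
  obtain ⟨hac, hbd⟩ := hne
  have h : (SimpleGraph.Walk.cons hab (.cons hbc (.cons hcd (.cons hda .nil)))).IsCycle := by
    have := hab.ne; have := hbc.ne; have := hcd.ne; have := hda.ne
    simp [SimpleGraph.Walk.cons_isCycle_iff, *]
    grind
  have := hG.trans (SimpleGraph.egirth_le_length h)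
  simp at this
  norm_cast at this

/-- If two non-consecutive vertices coincide, a 3-cycle splits off; otherwise the walk is a 5-cycle.
-/
lemma five_cycle_of_six_le_egirth (hG : 6 ≤ G.egirth) {a b c d e : W} (hab : G.Adj a b)
    (hbc : G.Adj b c) (hcd : G.Adj c d) (hde : G.Adj d e) : ¬ G.Adj e a := by
  intro hea
  have hac : a ≠ c := by rintro rfl; exact not_adj_of_six_le_egirth hG hcd hde hea
  have hbd : b ≠ d := by rintro rfl; exact not_adj_of_six_le_egirth hG hde hea hab
  have hce : c ≠ e := by rintro rfl; exact not_adj_of_six_le_egirth hG hea hab hbc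
  have hda : d ≠ a := by rintro rfl; exact not_adj_of_six_le_egirth hG hab hbc hcd
  have heb : e ≠ b := by rintro rfl; exact not_adj_of_six_le_egirth hG hbc hcd hde
  have h : (SimpleGraph.Walk.cons hab
      (.cons hbc (.cons hcd (.cons hde (.cons hea .nil))))).IsCycle := by
    have := hab.ne; have := hbc.ne; have := hcd.ne; have := hde.ne; have := hea.ne
    simp [SimpleGraph.Walk.cons_isCycle_iff, *]
    grind
  have := hG.trans (SimpleGraph.egirth_le_length h)
  simp at this
  norm_cast at this

end Girth

/-! ### Triangles and short cycles in links -/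

section Triangle

variable {V : Type*} {K : AbstractSimplicialComplex V} {u v w a b c d e : V}

lemma IsTriangle.rotate (h : IsTriangle K u v w) : IsTriangle K v w u := by
  obtain ⟨huv, huw, hvw, s, hs, hmem⟩ := h
  exact ⟨hvw, huv.symm, huw.symm, s, hs, fun x => (hmem x).trans (by tauto)⟩

lemma IsTriangle.swap (h : IsTriangle K u v w) : IsTriangle K u w v := by
  obtain ⟨huv, huw, hvw, s, hs, hmem⟩ := h
  exact ⟨huw, huv, hvw.symm, s, hs, fun x => (hmem x).trans (by tauto)⟩

lemma IsTriangle.adj (h : IsTriangle K u v w) : (oneSkeleton K).Adj u v := by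
  obtain ⟨huv, -, -, s, hs, hmem⟩ := h
  exact adj_of_mem_face hs (by simp [hmem]) (by simp [hmem]) huv

lemma IsTriangle.link_adj (h : IsTriangle K v a b) :
    (link K v).Adj ⟨a, h.adj⟩ ⟨b, h.swap.adj⟩ :=
  ⟨fun h' => h.2.2.1 (congrArg Subtype.val h'), h.2.2.2⟩

/-- The complexes all of whose vertex links have girth at least six. -/
def LinksGirthSix (K : AbstractSimplicialComplex V) : Prop :=
  ∀ v, 6 ≤ (link K v).egirth

lemma LinksGirthSix.no_three (hK : LinksGirthSix K) (h₁ : IsTriangle K v a b)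
    (h₂ : IsTriangle K v b c) : ¬ IsTriangle K v c a :=
  fun h₃ => not_adj_of_six_le_egirth (hK v) h₁.link_adj h₂.link_adj h₃.link_adj

lemma LinksGirthSix.four (hK : LinksGirthSix K) (h₁ : IsTriangle K v a b)
    (h₂ : IsTriangle K v b c) (h₃ : IsTriangle K v c d) (h₄ : IsTriangle K v d a) :
    a = c ∨ b = d := by
  simpa using four_cycle_of_six_le_egirth (hK v) h₁.link_adj h₂.link_adj h₃.link_adj h₄.link_adj

lemma LinksGirthSix.no_five (hK : LinksGirthSix K) (h₁ : IsTriangle K v a b)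
    (h₂ : IsTriangle K v b c) (h₃ : IsTriangle K v c d) (h₄ : IsTriangle K v d e) :
    ¬ IsTriangle K v e a :=
  fun h₅ => five_cycle_of_six_le_egirth (hK v) h₁.link_adj h₂.link_adj h₃.link_adj h₄.link_adj
    h₅.link_adj

end Triangle

-- Spheres of the covering

universe u

/-- A combinatorial sphere of the universal cover of `K` around a basepoint: its vertices with
their projections to `K`, the images `D` of their neighbours in the previous sphere, and the
edges `hor` inside the sphere. -/
structure Sphere {V : Type u} (K : AbstractSimplicialComplex V) where
  S : Type u
  f : S → V
  D : S → Set V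
  hor : S → S → Prop
  D_adj : ∀ {z d}, d ∈ D z → (oneSkeleton K).Adj (f z) d
  D_tri : ∀ {z d d'}, d ∈ D z → d' ∈ D z → d ≠ d' → IsTriangle K (f z) d d'
  hor_symm : ∀ {z z'}, hor z z' → hor z' z
  hor_unique : ∀ {z z₁ z₂}, hor z z₁ → hor z z₂ → f z₁ = f z₂ → z₁ = z₂
  hor_exists : ∀ {z d v}, d ∈ D z → v ∉ D z → IsTriangle K (f z) d v → ∃ z', hor z z' ∧ f z' = v
  hor_notMem : ∀ {z z'}, hor z z' → f z' ∉ D z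
  hor_low : ∀ {z z'}, hor z z' → ∃ d ∈ D z, d ∈ D z' ∧ IsTriangle K (f z) (f z') d

namespace Sphere

variable {V : Type u} {K : AbstractSimplicialComplex V} (L : Sphere K)

/-- The neighbours of the image of `z` that lift to the next sphere. -/
def Up (z : L.S) (y : V) : Prop :=
  (oneSkeleton K).Adj (L.f z) y ∧ y ∉ L.D z ∧ ∀ d ∈ L.D z, ¬ IsTriangle K (L.f z) d y

/-- The lifts of `y` upwards from `z` and from `z'` coincide. -/
def Rel (y : V) (z z' : L.S) : Prop :=
  z = z' ∨ L.hor z z' ∧ IsTriangle K (L.f z) (L.f z') y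

variable {L} {y : V} {z z' z₁ z₂ z₃ : L.S}

lemma Rel.symm (h : L.Rel y z z') : L.Rel y z' z := by
  rcases h with h | ⟨h, ht⟩
  · exact .inl h.symm
  · exact .inr ⟨L.hor_symm h, ht.rotate.swap⟩

lemma not_up_of_hor (h : L.hor z z') : ¬ L.Up z (L.f z') := by
  intro hu
  obtain ⟨d, hd, -, ht⟩ := L.hor_low h
  exact hu.2.2 d hd ht.swap

/-- With the lower neighbours shared with `z`, such a triangle closes up to a walk of length 3 or 4
in the link; a degenerate 4-cycle would identify a horizontal neighbour with a lower one. -/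
lemma not_isTriangle_of_hor (hK : LinksGirthSix K) (h₁ : L.hor z z₁) (h₂ : L.hor z z₂) :
    ¬ IsTriangle K (L.f z) (L.f z₁) (L.f z₂) := by
  intro ht
  obtain ⟨d₁, hd₁, -, ht₁⟩ := L.hor_low h₁
  obtain ⟨d₂, hd₂, -, ht₂⟩ := L.hor_low h₂
  by_cases hd : d₁ = d₂
  · subst hd
    exact hK.no_three ht ht₂ ht₁.swap
  · rcases hK.four ht ht₂ (L.D_tri hd₂ hd₁ (Ne.symm hd)) ht₁.swap with h | h
    · exact L.hor_notMem h₁ (h ▸ hd₂)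
    · exact L.hor_notMem h₂ (h ▸ hd₁)

lemma Up.of_hor (hK : LinksGirthSix K) (hu : L.Up z y) (h : L.hor z z')
    (ht : IsTriangle K (L.f z) (L.f z') y) : L.Up z' y := by
  obtain ⟨d, hd, hd', htd⟩ := L.hor_low h
  have h₁ : IsTriangle K (L.f z') y (L.f z) := ht.rotate
  have h₂ : IsTriangle K (L.f z') (L.f z) d := htd.rotate.swap
  have hyd : y ≠ d := fun h => hu.2.1 (h ▸ hd)
  refine ⟨h₁.adj, fun hy => ?_, fun e he hte => ?_⟩
  · exact hK.no_three h₁ h₂ (L.D_tri hd' hy hyd.symm)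
  · by_cases hde : d = e
    · subst hde
      exact hK.no_three h₁ h₂ hte
    · rcases hK.four h₁ h₂ (L.D_tri hd' he hde) hte with h' | h'
      · exact hyd h'
      · exact L.hor_notMem (L.hor_symm h) (h' ▸ he)

lemma Rel.up (hK : LinksGirthSix K) (hu : L.Up z y) (h : L.Rel y z z') : L.Up z' y := by
  rcases h with rfl | ⟨h, ht⟩
  · exact hu
  · exact hu.of_hor hK h ht

/-- Joined through `y` and through lower neighbours, `z₁` and `z₂` lie on a closed walk of length 4
or 5 in the link of `L.f z`. Length 5 is impossible, and length 4 forces equal images. -/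
lemma eq_of_hor_of_hor (hK : LinksGirthSix K) (hu : L.Up z y) (h₁ : L.hor z z₁)
    (h₂ : L.hor z z₂) (ht₁ : IsTriangle K (L.f z) (L.f z₁) y)
    (ht₂ : IsTriangle K (L.f z) (L.f z₂) y) : z₁ = z₂ := by
  refine L.hor_unique h₁ h₂ ?_
  obtain ⟨d₁, hd₁, -, hd₁t⟩ := L.hor_low h₁
  obtain ⟨d₂, hd₂, -, hd₂t⟩ := L.hor_low h₂
  by_cases hd : d₁ = d₂
  · subst hd
    rcases hK.four ht₁.swap hd₁t hd₂t.swap ht₂ with h | h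
    · exact absurd (h ▸ hd₁) hu.2.1
    · exact h
  · exact absurd ht₂ (hK.no_five ht₁.swap hd₁t (L.D_tri hd₁ hd₂ hd) hd₂t.swap)

/-- Two nontrivial steps out of `z₂` end at the same vertex, so no transitive closure is needed and
an upward lift has at most two lower neighbours. -/
lemma Rel.trans (hK : LinksGirthSix K) (hu : L.Up z₂ y) (h₁ : L.Rel y z₁ z₂)
    (h₂ : L.Rel y z₂ z₃) : L.Rel y z₁ z₃ := by
  rcases h₁.symm with rfl | ⟨h₁', ht₁⟩
  · exact h₂
  rcases h₂ with rfl | ⟨h₂', ht₂⟩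
  · exact h₁
  exact .inl (eq_of_hor_of_hor hK hu h₁' h₂' ht₁ ht₂)

/-! ### Constructing the next sphere -/

variable (L)

/-- The vertices of the next sphere: pairs of a vertex of `K` and the set of its lower
neighbours. -/
def NextS : Type u :=
  {q : Set L.S × V // ∃ z, L.Up z q.2 ∧ q.1 = {z' | L.Rel q.2 z z'}}

variable {L}

/-- The neighbours in the previous sphere. -/
def NextS.lower (q : L.NextS) : Set L.S := q.1.1

/-- The image in `K`. -/
def NextS.proj (q : L.NextS) : V := q.1.2

/-- The lift of `y` upwards from `z`. -/
def NextS.mk (z : L.S) (y : V) (h : L.Up z y) : L.NextS :=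
  ⟨({z' | L.Rel y z z'}, y), z, h, rfl⟩

namespace NextS

variable {q q' : L.NextS}

lemma mem_lower_mk (h : L.Up z y) : z ∈ (mk z y h).lower := .inl rfl

lemma exists_mem_lower (q : L.NextS) : ∃ z, z ∈ q.lower := by
  obtain ⟨z, -, h⟩ := q.2
  refine ⟨z, ?_⟩
  rw [lower, h]
  exact .inl rfl

lemma up_of_mem (hK : LinksGirthSix K) (h : z ∈ q.lower) : L.Up z q.proj := by
  obtain ⟨z₀, hu, hq⟩ := q.2
  have h' : L.Rel q.1.2 z₀ z := by
    have : z ∈ q.1.1 := h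
    rwa [hq] at this
  exact h'.up hK hu

lemma mem_lower_iff (hK : LinksGirthSix K) (h : z ∈ q.lower) :
    z' ∈ q.lower ↔ L.Rel q.proj z z' := by
  obtain ⟨z₀, hu, hq⟩ := q.2
  have h₀ {x} : x ∈ q.lower ↔ L.Rel q.proj z₀ x := by
    change x ∈ q.1.1 ↔ _
    rw [hq]
    rfl
  rw [h₀]
  exact ⟨fun h' => ((h₀.1 h).symm).trans hK hu h',
    fun h' => (h₀.1 h).trans hK (up_of_mem hK h) h'⟩

lemma ext_of_mem (hK : LinksGirthSix K) (h : z ∈ q.lower) (h' : z ∈ q'.lower)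
    (hp : q.proj = q'.proj) : q = q' := by
  refine Subtype.ext (Prod.ext (Set.ext fun x => ?_) hp)
  exact (mem_lower_iff hK h).trans (hp ▸ (mem_lower_iff hK h').symm)

lemma hor_of_mem (hK : LinksGirthSix K) (h : z ∈ q.lower) (h' : z' ∈ q.lower) (hne : z ≠ z') :
    L.hor z z' ∧ IsTriangle K (L.f z) (L.f z') q.proj :=
  ((mem_lower_iff hK h).1 h').resolve_left hne

end NextS

variable (L)

/-- The sphere of the next larger radius. -/
def next (hK : LinksGirthSix K) : Sphere K where
  S := L.NextS
  f := NextS.proj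
  D q := L.f '' q.lower
  hor q q' := ∃ z ∈ q.lower, z ∈ q'.lower ∧ IsTriangle K (L.f z) q.proj q'.proj
  D_adj := by
    rintro q _ ⟨z, hz, rfl⟩
    exact (NextS.up_of_mem hK hz).1.symm
  D_tri := by
    rintro q _ _ ⟨z, hz, rfl⟩ ⟨z', hz', rfl⟩ hne
    exact (NextS.hor_of_mem hK hz hz' fun h => hne (h ▸ rfl)).2.rotate.rotate
  hor_symm := by
    rintro q q' ⟨z, hz, hz', h⟩
    exact ⟨z, hz', hz, h.swap⟩
  hor_unique := by
    rintro q q₁ q₂ ⟨z₁, hz₁, hz₁', h₁⟩ ⟨z₂, hz₂, hz₂', h₂⟩ hq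
    -- Distinct `z₁`, `z₂` are adjacent in the link of `q.proj`, and the common image of `q₁`, `q₂`
    -- would complete a 3-cycle there.
    by_cases h : z₁ = z₂
    · subst h
      exact NextS.ext_of_mem hK hz₁' hz₂' hq
    · obtain ⟨-, ht⟩ := NextS.hor_of_mem hK hz₁ hz₂ h
      rw [hq] at h₁
      exact absurd h₁.rotate (hK.no_three ht.rotate.rotate h₂.rotate.swap)
  hor_exists := by
    rintro q _ v ⟨z, hz, rfl⟩ hv ht
    -- Otherwise `v` is a lower neighbour of `z`, contradicting that `q` lies above `z`, or lifts to
    -- a horizontal neighbour of `z`, which then also lies below `q`, against `hv`.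
    have hu : L.Up z v := by
      refine ⟨ht.rotate.adj, fun hvz => ?_, fun d hd htd => ?_⟩
      · exact (NextS.up_of_mem hK hz).2.2 v hvz ht.rotate
      · by_cases hvD : v ∈ L.D z
        · exact (NextS.up_of_mem hK hz).2.2 v hvD ht.rotate
        · obtain ⟨z', hzz', rfl⟩ := L.hor_exists hd hvD htd
          exact hv ⟨z', (NextS.mem_lower_iff hK hz).2 (.inr ⟨hzz', ht.rotate⟩), rfl⟩
    exact ⟨NextS.mk z v hu, ⟨z, hz, NextS.mem_lower_mk hu, ht.rotate.swap⟩, rfl⟩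
  hor_notMem := by
    rintro q q' ⟨z, hz, hz', h⟩ ⟨z', hz₁, hz₂⟩
    by_cases hne : z = z'
    · subst hne
      exact (NextS.up_of_mem hK hz').1.ne hz₂
    · have := NextS.up_of_mem hK hz'
      rw [← hz₂] at this
      exact not_up_of_hor (NextS.hor_of_mem hK hz hz₁ hne).1 this
  hor_low := by
    rintro q q' ⟨z, hz, hz', h⟩
    exact ⟨L.f z, ⟨z, hz, rfl⟩, ⟨z, hz', rfl⟩, h.rotate⟩

/-! ### The covering assembled from the spheres -/

section Cover

variable {V : Type u} {K : AbstractSimplicialComplex V} (hK : LinksGirthSix K) (base : V)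

/-- The sphere of radius zero. -/
def point (K : AbstractSimplicialComplex V) (base : V) : Sphere K where
  S := PUnit
  f _ := base
  D _ := ∅
  hor _ _ := False
  D_adj h := h.elim
  D_tri h := h.elim
  hor_symm h := h
  hor_unique h := h.elim
  hor_exists h := h.elim
  hor_notMem h := h.elim
  hor_low h := h.elim

/-- The sphere of radius `n` around a lift of `base` in the universal cover. -/
def sphere : ℕ → Sphere K
  | 0 => point K base
  | n + 1 => (sphere n).next hK

/-- The vertices of the universal cover. -/
abbrev Cover : Type u := Σ n, (sphere hK base n).S

variable {hK base}

/-- The covering projection on vertices. -/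
def Cover.proj (a : Cover hK base) : V := (sphere hK base a.1).f a.2

/-- The 1-skeleton of the universal cover. -/
inductive Cover.Adj : Cover hK base → Cover hK base → Prop
  | hor {n : ℕ} {a b : (sphere hK base n).S} (h : (sphere hK base n).hor a b) :
      Adj ⟨n, a⟩ ⟨n, b⟩
  | up {n : ℕ} {a : (sphere hK base n).S} {b : (sphere hK base n).NextS} (h : a ∈ b.lower) :
      Adj ⟨n, a⟩ ⟨n + 1, b⟩
  | down {n : ℕ} {a : (sphere hK base n).NextS} {b : (sphere hK base n).S} (h : b ∈ a.lower) :
      Adj ⟨n + 1, a⟩ ⟨n, b⟩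

namespace Cover

lemma Adj.symm {a b : Cover hK base} (h : Adj a b) : Adj b a := by
  cases h with
  | hor h => exact .hor ((sphere hK base _).hor_symm h)
  | up h => exact .down h
  | down h => exact .up h

lemma exists_adj (a : Cover hK base) (v : V) (h : (oneSkeleton K).Adj a.proj v) :
    ∃ b, Adj a b ∧ b.proj = v := by
  obtain ⟨n, a⟩ := a
  by_cases hD : v ∈ (sphere hK base n).D a
  · cases n with
    | zero => exact hD.elim
    | succ n =>
      obtain ⟨z, hz, rfl⟩ := hD
      exact ⟨⟨n, z⟩, .down hz, rfl⟩
  by_cases hH : ∃ d ∈ (sphere hK base n).D a, IsTriangle K ((sphere hK base n).f a) d v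
  · obtain ⟨d, hd, ht⟩ := hH
    obtain ⟨b, hab, hb⟩ := (sphere hK base n).hor_exists hd hD ht
    exact ⟨⟨n, b⟩, .hor hab, hb⟩
  · push Not at hH
    exact ⟨⟨n + 1, NextS.mk a v ⟨h, hD, hH⟩⟩, .up (NextS.mem_lower_mk _), rfl⟩

/-- Lower, horizontal and upward neighbours have disjoint images. Within each kind the image
determines the neighbour; two distinct lower neighbours are adjacent, hence have distinct images. -/
lemma adj_unique {a b c : Cover hK base} (hab : Adj a b) (hac : Adj a c)
    (h : b.proj = c.proj) : b = c := by
  have up_of_eq {n : ℕ} {z : (sphere hK base n).S} {q : (sphere hK base n).NextS} {v : V}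
      (hz : z ∈ q.lower) (hv : q.proj = v) : (sphere hK base n).Up z v :=
    hv ▸ NextS.up_of_mem hK hz
  cases hab with
  | hor hab =>
    cases hac with
    | hor hac => rw [(sphere hK base _).hor_unique hab hac h]
    | up hac => exact (not_up_of_hor hab (up_of_eq hac h.symm)).elim
    | down hac => exact ((sphere hK base _).hor_notMem hab ⟨_, hac, h.symm⟩).elim
  | up hab =>
    cases hac with
    | hor hac => exact (not_up_of_hor hac (up_of_eq hab h)).elim
    | up hac => rw [NextS.ext_of_mem hK hab hac h]
    | down hac => exact ((up_of_eq hab h).2.1 ⟨_, hac, rfl⟩).elim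
  | down hab =>
    cases hac with
    | hor hac => exact ((sphere hK base _).hor_notMem hac ⟨_, hab, h⟩).elim
    | up hac => exact ((up_of_eq hac h.symm).2.1 ⟨_, hab, rfl⟩).elim
    | @down _ _ c hac =>
      by_contra hne
      obtain ⟨-, ht⟩ := NextS.hor_of_mem hK hab hac (fun h => hne (h ▸ rfl))
      exact ht.1 h

/-- Link girth excludes two horizontal edges at a vertex spanning a triangle, and `Up` excludes a
downward and an upward one. In the other cases the third edge comes from how lower sets and
horizontal edges are defined. -/
lemma adj_of_isTriangle {a b c : Cover hK base} (hab : Adj a b) (hac : Adj a c)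
    (h : IsTriangle K a.proj b.proj c.proj) : Adj b c := by
  have hor_down {n : ℕ} {a b : (sphere hK base (n + 1)).S} {c : (sphere hK base n).S}
      (hab : (sphere hK base (n + 1)).hor a b) (hac : c ∈ NextS.lower a)
      (h : IsTriangle K ((sphere hK base (n + 1)).f a) ((sphere hK base (n + 1)).f b)
        ((sphere hK base n).f c)) : c ∈ NextS.lower b := by
    obtain ⟨z, hz, hz', ht⟩ := id hab
    by_cases hzc : z = c
    · exact hzc ▸ hz'
    · have ht' := (NextS.hor_of_mem hK hz hac hzc).2
      exact (hK.no_three ht'.rotate.rotate h.swap ht.rotate).elim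
  have hor_up {n : ℕ} {a b : (sphere hK base n).S} {c : (sphere hK base n).NextS}
      (hab : (sphere hK base n).hor a b) (hac : a ∈ c.lower)
      (h : IsTriangle K ((sphere hK base n).f a) ((sphere hK base n).f b) c.proj) :
      b ∈ c.lower :=
    (NextS.mem_lower_iff hK hac).2 (.inr ⟨hab, h⟩)
  have up_down {n : ℕ} {b : (sphere hK base n).S} {a : (sphere hK base n).NextS}
      {c : (sphere hK base (n + 1)).NextS} (hab : b ∈ a.lower) (hac : a ∈ c.lower)
      (h : IsTriangle K a.proj ((sphere hK base n).f b) c.proj) : False :=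
    (NextS.up_of_mem hK hac).2.2 _ ⟨b, hab, rfl⟩ h
  cases hab with
  | hor hab =>
    cases hac with
    | hor hac => exact (not_isTriangle_of_hor hK hab hac h).elim
    | up hac => exact .up (hor_up hab hac h)
    | down hac => exact .down (hor_down hab hac h)
  | up hab =>
    cases hac with
    | hor hac => exact .down (hor_up hac hab h.swap)
    | up hac => exact .hor ⟨_, hab, hac, h⟩
    | down hac => exact (up_down hac hab h.swap).elim
  | down hab =>
    cases hac with
    | hor hac => exact .up (hor_down hac hab h.swap)
    | up hac => exact (up_down hab hac h).elim
    | @down _ _ c hac =>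
      refine .hor (NextS.hor_of_mem hK hab hac ?_).1
      rintro rfl
      exact h.2.2.1 rfl

lemma exists_walk_proj {n : ℕ} (a : (sphere hK base n).S) :
    ∃ w : (oneSkeleton K).Walk base ((sphere hK base n).f a), w.length = n := by
  induction n with
  | zero => exact ⟨.nil, rfl⟩
  | succ n ih =>
    obtain ⟨z, hz⟩ := NextS.exists_mem_lower a
    obtain ⟨w, hw⟩ := ih z
    exact ⟨w.concat (NextS.up_of_mem hK hz).1,
      (SimpleGraph.Walk.length_concat _ _).trans (congrArg (· + 1) hw)⟩

lemma Adj.level_le {a b : Cover hK base} (h : Adj a b) : b.1 ≤ a.1 + 1 := by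
  cases h with
  | hor h => exact Nat.le_succ _
  | up h => exact le_rfl
  | down h => exact (Nat.le_succ _).trans (Nat.le_succ _)

/-- The triangle condition upstairs: level zero has no horizontal edges, and higher ones are defined
through a common lower vertex. -/
lemma Adj.exists_common_lower {a b : Cover hK base} (h : Adj a b) (hab : a.1 = b.1) :
    ∃ c : Cover hK base, c.1 + 1 = a.1 ∧ (oneSkeleton K).Adj a.proj c.proj ∧
      (oneSkeleton K).Adj c.proj b.proj := by
  cases h with
  | @hor n a b h =>
    cases n with
    | zero => exact h.elim
    | succ n =>
      obtain ⟨z, hza, hzb, -⟩ := h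
      exact ⟨⟨n, z⟩, rfl, (NextS.up_of_mem hK hza).1.symm, (NextS.up_of_mem hK hzb).1⟩
  | up h => exact absurd hab (Nat.succ_ne_self _).symm
  | down h => exact absurd hab (Nat.succ_ne_self _)

end Cover

end Cover

end Sphere

/-! ### The triangle condition and comparison of distances -/

section Distance

variable {V : Type u} {K : AbstractSimplicialComplex V}

open Sphere

/-- The triangle condition: two adjacent vertices at the same distance from the basepoint have a
common neighbour one step closer to the basepoint. -/
theorem IsTwoDimSystolic.triangle_condition (hY : IsTwoDimSystolic K) (base : V) {u v : V}
    (huv : (oneSkeleton K).Adj u v)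
    (hd : (oneSkeleton K).dist base u = (oneSkeleton K).dist base v) :
    ∃ w, (oneSkeleton K).Adj u w ∧ (oneSkeleton K).Adj w v ∧
      (oneSkeleton K).dist base w + 1 = (oneSkeleton K).dist base u := by
  have hK : LinksGirthSix K := hY.girth_link
  have := hY.simplyConnected
  have hconn : (oneSkeleton K).Connected := connected_oneSkeleton
  obtain ⟨g, hg₀, hg, hadj⟩ := exists_section_of_unique_lifts (K := K)
    (Cover.proj (hK := hK) (base := base)) Cover.Adj Cover.Adj.symm Cover.exists_adj
    Cover.adj_unique Cover.adj_of_isTriangle ⟨0, PUnit.unit⟩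
  have hg₀' : (g base).1 = 0 := congrArg Sigma.fst hg₀
  have hle {x y : V} (w : (oneSkeleton K).Walk x y) : (g y).1 ≤ (g x).1 + w.length := by
    induction w with
    | nil => simp
    | cons h _ ih =>
      have := (hadj _ _ h).level_le
      rw [SimpleGraph.Walk.length_cons]
      omega
  have hdist (a : Cover hK base) : (oneSkeleton K).dist base a.proj ≤ a.1 := by
    obtain ⟨w, hw⟩ := Cover.exists_walk_proj a.2
    exact (SimpleGraph.dist_le w).trans_eq hw
  -- The level rises by at most one along each lifted edge, starting from zero; conversely a vertex
  -- of level `n` projects to distance at most `n`.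
  have hlevel (x : V) : (g x).1 = (oneSkeleton K).dist base x := by
    apply le_antisymm
    · obtain ⟨w, hw⟩ := (hconn.preconnected base x).exists_walk_length_eq_dist
      have := hle w
      omega
    · have h := hdist (g x)
      rwa [hg] at h
  obtain ⟨c, hc, huc, hcv⟩ := (hadj u v huv).exists_common_lower (by rw [hlevel, hlevel, hd])
  rw [hg] at huc hcv
  refine ⟨c.proj, huc, hcv, ?_⟩
  -- The level of `c` bounds its distance from above; adjacency to `u` bounds it from below.
  have h₁ := hdist c
  have h₂ := hconn.dist_triangle (u := base) (v := c.proj) (w := u)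
  rw [SimpleGraph.dist_eq_one_iff_adj.2 huc.symm] at h₂
  have h₃ := hlevel u
  omega

lemma squaringSkeleton_le (base : V) : squaringSkeleton K base ≤ oneSkeleton K :=
  fun _ _ h => h.1

lemma IsTwoDimSystolic.exists_walk_squaringSkeleton (hY : IsTwoDimSystolic K) (base : V)
    {u v : V} (p : (oneSkeleton K).Walk u v) :
    ∃ q : (squaringSkeleton K base).Walk u v, q.length ≤ 2 * p.length := by
  induction p with
  | nil => exact ⟨.nil, by simp⟩
  | @cons u v w h p ih =>
    obtain ⟨q, hq⟩ := ih
    by_cases hd : (oneSkeleton K).dist base u = (oneSkeleton K).dist base v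
    · obtain ⟨x, hux, hxv, hx⟩ := hY.triangle_condition base h hd
      have hux' : (squaringSkeleton K base).Adj u x := ⟨hux, by omega⟩
      have hxv' : (squaringSkeleton K base).Adj x v := ⟨hxv, by omega⟩
      refine ⟨.cons hux' (.cons hxv' q), ?_⟩
      simp only [SimpleGraph.Walk.length_cons]
      omega
    · have h' : (squaringSkeleton K base).Adj u v := ⟨h, hd⟩
      refine ⟨.cons h' q, ?_⟩
      simp only [SimpleGraph.Walk.length_cons]
      omega

end Distance

end SystolicSquaring

theorem mainTheorem3 {V : Type*} (Y : AbstractSimplicialComplex V) (base : V)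
    (hY : IsTwoDimSystolic Y) :
    QuasiIsometric (oneSkeleton Y) (squaring Y base).skeleton ∧
      IsQuasiIsometry (oneSkeleton Y) (squaring Y base).skeleton id ∧
      ∀ u v : V,
        (oneSkeleton Y).dist u v ≤ (squaring Y base).skeleton.dist u v ∧
          (squaring Y base).skeleton.dist u v ≤ 2 * (oneSkeleton Y).dist u v := by
  have := hY.simplyConnected
  have hY₁ : (oneSkeleton Y).Connected := connected_oneSkeleton
  have hX : (squaring Y base).skeleton.Connected := by
    have : Nonempty V := ⟨base⟩
    refine ⟨fun u v => ?_⟩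
    obtain ⟨p⟩ := hY₁.preconnected u v
    obtain ⟨q, -⟩ := hY.exists_walk_squaringSkeleton base p
    exact ⟨q⟩
  have hdist (u v : V) : (oneSkeleton Y).dist u v ≤ (squaring Y base).skeleton.dist u v ∧
      (squaring Y base).skeleton.dist u v ≤ 2 * (oneSkeleton Y).dist u v := by
    constructor
    · obtain ⟨q, hq⟩ := (hX.preconnected u v).exists_walk_length_eq_dist
      rw [← hq]
      exact (SimpleGraph.dist_le (q.mapLe (squaringSkeleton_le base))).trans_eq
        (SimpleGraph.Walk.length_map _ _)
    · obtain ⟨p, hp⟩ := (hY₁.preconnected u v).exists_walk_length_eq_dist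
      obtain ⟨q, hq⟩ := hY.exists_walk_squaringSkeleton base p
      rw [← hp]
      exact (SimpleGraph.dist_le q).trans hq
  have hqi : IsQuasiIsometry (oneSkeleton Y) (squaring Y base).skeleton id := by
    refine ⟨2, 0, one_le_two, le_rfl, fun u v => ?_, fun w => ⟨w, by simp⟩⟩
    obtain ⟨h₁, h₂⟩ := hdist u v
    have h₁' : ((oneSkeleton Y).dist u v : ℝ) ≤ (squaring Y base).skeleton.dist u v := by
      exact_mod_cast h₁
    have h₂' : ((squaring Y base).skeleton.dist u v : ℝ) ≤ 2 * (oneSkeleton Y).dist u v := by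
      exact_mod_cast h₂
    have h₃ : (0 : ℝ) ≤ (oneSkeleton Y).dist u v := Nat.cast_nonneg _
    simp only [id]
    constructor <;> linarith
  exact ⟨⟨hY₁, hX, id, hqi⟩, hqi, hdist⟩
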